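/- An orthogonal category $\overline{\mathbf{C}} = (\mathbf{C},\perp)$ is a small category $\mathbf{C}$ together with a relation $\perp$ on pairs of morphisms with a common target such that $f_1\perp f_2$ implies $f_2\perp f_1$, and $f_1\perp f_2$ implies $(g\,f_1\,h_1)\perp(g\,f_2\,h_2)$ for all composable morphisms $g,h_1,h_2$ of $\mathbf{C}$. Let $(\mathbf{M},\otimes,I)$ be a closed symmetric monoidal category in which all small limits and colimits exist, and let $\mathbf{Alg}_{\mathsf{As}}(\mathbf{M})$ be the category of associative and unital algebras (monoid objects) in $\mathbf{M}$. An $\mathbf{M}$-valued AQFT on $\overline{\mathbf{C}}$ is a functor $\mathfrak{A}:\mathbf{C}\to\mathbf{Alg}_{\mathsf{As}}(\mathbf{M})$ such that, for all $f_1:c_1\to c$ and $f_2:c_2\to c$ with $f_1\perp f_2$, $$\mu_c\circ\big(\mathfrak{A}(f_1)\otimes\mathfrak{A}(f_2)\big)=\mu_c^{\mathrm{op}}\circ\big(\mathfrak{A}(f_1)\otimes\mathfrak{A}(f_2)\big)$$ as morphisms $\mathfrak{A}(c_1)\otimes\mathfrak{A}(c_2)\to\mathfrak{A}(c)$ in $\mathbf{M}$,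 where $\mu_c$ is the multiplication of $\mathfrak{A}(c)$ and $\mu_c^{\mathrm{op}}$ is its composite with the symmetry of $\mathbf{M}$. Let $\mathbf{QFT}(\overline{\mathbf{C}})$ be the full subcategory of the functor category $\mathbf{Alg}_{\mathsf{As}}(\mathbf{M})^{\mathbf{C}}$ on the $\mathbf{M}$-valued AQFTs. Proposition 2.7. For every orthogonal category $\overline{\mathbf{C}}$ and every closed symmetric monoidal category $\mathbf{M}$ with all small limits and colimits, the category $\mathbf{QFT}(\overline{\mathbf{C}})$ of $\mathbf{M}$-valued AQFTs on $\overline{\mathbf{C}}$ has all small limits and all small colimits. -/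

import Mathlib

open CategoryTheory MonoidalCategory Limits

universe w v u

/-- An orthogonality relation on a category `C`: a symmetric relation on pairs of morphisms with a
common target that is stable under postcomposition (with a common morphism) and precomposition. An
orthogonal category is a small category together with an orthogonality relation. -/
structure OrthogonalityRelation (C : Type w) [SmallCategory C] where
  /-- `Perp f₁ f₂` means that `f₁` and `f₂` are orthogonal. -/
  Perp : ∀ {c₁ c₂ c : C}, (c₁ ⟶ c) → (c₂ ⟶ c) → Prop
  symm : ∀ {c₁ c₂ c : C} {f₁ : c₁ ⟶ c} {f₂ : c₂ ⟶ c}, Perp f₁ f₂ → Perp f₂ f₁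
  comp_stable : ∀ {b₁ b₂ c₁ c₂ c d : C} {f₁ : c₁ ⟶ c} {f₂ : c₂ ⟶ c}
    (g : c ⟶ d) (h₁ : b₁ ⟶ c₁) (h₂ : b₂ ⟶ c₂),
    Perp f₁ f₂ → Perp (h₁ ≫ f₁ ≫ g) (h₂ ≫ f₂ ≫ g)

/-- The property of a functor `𝔄 : C ⥤ Mon M` to the associative and unital algebras (monoid
objects) in `M` that, for all `f₁ : c₁ ⟶ c` and `f₂ : c₂ ⟶ c` with `f₁ ⊥ f₂`, the multiplication
and the opposite multiplication of `𝔄 c` agree after `𝔄 f₁ ⊗ 𝔄 f₂ : 𝔄 c₁ ⊗ 𝔄 c₂ ⟶ 𝔄 c ⊗ 𝔄 c`. -/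
def IsPerpCommutative {C : Type w} [SmallCategory C] (O : OrthogonalityRelation C)
    (M : Type u) [Category.{v} M] [MonoidalCategory M] [SymmetricCategory M] :
    ObjectProperty (C ⥤ Mon M) :=
  fun 𝔄 => ∀ ⦃c₁ c₂ c : C⦄ (f₁ : c₁ ⟶ c) (f₂ : c₂ ⟶ c), O.Perp f₁ f₂ →
    ((𝔄.map f₁).hom ⊗ₘ (𝔄.map f₂).hom) ≫ MonObj.mul (X := (𝔄.obj c).X) =
      ((𝔄.map f₁).hom ⊗ₘ (𝔄.map f₂).hom) ≫
        (β_ (𝔄.obj c).X (𝔄.obj c).X).hom ≫ MonObj.mul (X := (𝔄.obj c).X)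

/-- The category of `M`-valued algebraic quantum field theories on the orthogonal category `(C, O)`:
the full subcategory of the functor category `C ⥤ Mon M` on the `⊥`-commutative functors. -/
abbrev QFT {C : Type w} [SmallCategory C] (O : OrthogonalityRelation C)
    (M : Type u) [Category.{v} M] [MonoidalCategory M] [SymmetricCategory M] :=
  (IsPerpCommutative O M).FullSubcategory

/-! `QFT O M` is a reflective subcategory of `C ⥤ Mon M`, so it inherits limits and colimits from
there, and hence from `Mon M`. Limits in `Mon M` are computed in `M`; colimits and the reflector
both rest on quotients of monoids by relations. Since `M` is closed, tensoring preserves colimits in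
each variable. Hence the coequalizer of the two-sided extensions of a parallel pair is again a
monoid (`exists_mon_quotient`), and the coproduct of tensor powers is the free monoid. A colimit of
monoids is the free monoid on the colimit of the underlying objects, modulo the units and products
of the given monoids (`hasColimitsOfSize_mon`). The reflector imposes the commutation relations
objectwise; stability of `⊥` under postcomposition makes the quotients functorial
(`exists_perpCommutative_reflection`). -/

/-! ### Quotients of monoid objects. -/

section Quotient

open MonObj

variable {M : Type u} [Category.{v} M] [MonoidalCategory M]

/-- The two-sided `A`-linear extension `a ⊗ x ⊗ b ↦ a * r x * b` of a morphism `r : X ⟶ A` to a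
monoid object `A`. -/
def biact (A : M) [MonObj A] {X : M} (r : X ⟶ A) : A ⊗ X ⊗ A ⟶ A :=
  A ◁ (r ▷ A ≫ μ) ≫ μ

variable {A : M} [MonObj A] {X : M} (r : X ⟶ A)

lemma biact_comp {B : M} [MonObj B] (f : A ⟶ B) [IsMonHom f] :
    biact A r ≫ f = (f ⊗ₘ (r ≫ f) ⊗ₘ f) ≫ B ◁ μ ≫ μ := by
  simp only [biact, Category.assoc, IsMonHom.mul_hom, ← tensorHom_id, ← id_tensorHom,
    tensorHom_comp_tensorHom_assoc, Category.id_comp, Category.comp_id]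

/-- With the next lemma: the extension is a bimodule map, so the relations it generates form a
two-sided ideal. -/
lemma whiskerLeft_biact_mul :
    A ◁ biact A r ≫ μ = (α_ A A (X ⊗ A)).inv ≫ μ ▷ (X ⊗ A) ≫ biact A r := by
  rw [biact, ← whisker_exchange_assoc]
  simp

lemma biact_whiskerRight_mul :
    biact A r ▷ A ≫ μ = (α_ A (X ⊗ A) A).hom ≫ A ◁ ((α_ X A A).hom ≫ X ◁ μ) ≫ biact A r := by
  have h : (r ▷ A ≫ μ) ▷ A ≫ μ = (α_ X A A).hom ≫ X ◁ μ ≫ r ▷ A ≫ μ := by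
    rw [whisker_exchange_assoc]; simp
  rw [biact, comp_whiskerRight, Category.assoc, MonObj.mul_assoc,
    associator_naturality_middle_assoc, ← MonoidalCategory.whiskerLeft_comp_assoc, h]
  simp

/-- Inserting units on both sides recovers `r`, so coequalizing the extensions also coequalizes the
original pair. -/
lemma one_biact_one :
    (λ_ X).inv ≫ η[A] ▷ X ≫ A ◁ ((ρ_ X).inv ≫ X ◁ η[A]) ≫ biact A r = r := by
  rw [biact, ← MonoidalCategory.whiskerLeft_comp_assoc, Category.assoc, whisker_exchange_assoc,
    MonObj.mul_one, rightUnitor_naturality, Iso.inv_hom_id_assoc, ← whisker_exchange_assoc,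
    MonObj.one_mul, leftUnitor_naturality, Iso.inv_hom_id_assoc]

variable {s : X ⟶ A} {r}

lemma biact_comp_eq {B : M} [MonObj B] (f : A ⟶ B) [IsMonHom f] (h : r ≫ f = s ≫ f) :
    biact A r ≫ f = biact A s ≫ f := by
  rw [biact_comp, biact_comp, h]

lemma comp_eq_of_biact_comp_eq {Y : M} (f : A ⟶ Y) (h : biact A r ≫ f = biact A s ≫ f) :
    r ≫ f = s ≫ f := by
  rw [← one_biact_one r, ← one_biact_one s]
  simp only [Category.assoc, h]

variable [SymmetricCategory M] [MonoidalClosed M]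

instance epi_whiskerLeft (Z : M) {X Y : M} (f : X ⟶ Y) [Epi f] : Epi (Z ◁ f) :=
  inferInstanceAs (Epi ((tensorLeft Z).map f))

instance epi_whiskerRight (Z : M) {X Y : M} (f : X ⟶ Y) [Epi f] : Epi (f ▷ Z) := by
  have : f ▷ Z = (β_ X Z).hom ≫ Z ◁ f ≫ (β_ Y Z).inv := by simp
  rw [this]; infer_instance

instance epi_tensorHom {X Y X' Y' : M} (f : X ⟶ Y) (g : X' ⟶ Y') [Epi f] [Epi g] :
    Epi (f ⊗ₘ g) := by
  rw [MonoidalCategory.tensorHom_def]; infer_instance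

omit [SymmetricCategory M] in
-- Tensoring with `Z` is a left adjoint; currying reduces to the universal property of the
-- coequalizer.
lemma exists_whiskerLeft_coequalizer_desc {R A : M} (f g : R ⟶ A) [HasCoequalizer f g] {Z Y : M}
    (k : Z ⊗ A ⟶ Y) (h : Z ◁ f ≫ k = Z ◁ g ≫ k) :
    ∃ l : Z ⊗ coequalizer f g ⟶ Y, Z ◁ coequalizer.π f g ≫ l = k := by
  refine ⟨MonoidalClosed.uncurry (coequalizer.desc (MonoidalClosed.curry k) ?_), ?_⟩
  · simp only [← MonoidalClosed.curry_natural_left, h]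
  · rw [← MonoidalClosed.uncurry_natural_left, coequalizer.π_desc, MonoidalClosed.uncurry_curry]

lemma exists_whiskerRight_coequalizer_desc {R A : M} (f g : R ⟶ A) [HasCoequalizer f g] {Z Y : M}
    (k : A ⊗ Z ⟶ Y) (h : f ▷ Z ≫ k = g ▷ Z ≫ k) :
    ∃ l : coequalizer f g ⊗ Z ⟶ Y, coequalizer.π f g ▷ Z ≫ l = k := by
  obtain ⟨l, hl⟩ := exists_whiskerLeft_coequalizer_desc f g ((β_ Z A).hom ≫ k) (by
    simp only [BraidedCategory.braiding_naturality_right_assoc, h])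
  refine ⟨(β_ _ _).hom ≫ l, ?_⟩
  rw [BraidedCategory.braiding_naturality_left_assoc, hl, SymmetricCategory.symmetry_assoc]

lemma exists_mul_coequalizer_biact (r s : X ⟶ A) [HasCoequalizer (biact A r) (biact A s)] :
    ∃ m : coequalizer (biact A r) (biact A s) ⊗ coequalizer (biact A r) (biact A s) ⟶
        coequalizer (biact A r) (biact A s),
      (coequalizer.π (biact A r) (biact A s) ⊗ₘ coequalizer.π (biact A r) (biact A s)) ≫ m =
        μ ≫ coequalizer.π (biact A r) (biact A s) := by
  set π := coequalizer.π (biact A r) (biact A s) with hπ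
  have hc : biact A r ≫ π = biact A s ≫ π := coequalizer.condition _ _
  -- The product descends in one variable at a time, second factor first.
  obtain ⟨l, hl⟩ := exists_whiskerLeft_coequalizer_desc (biact A r) (biact A s) (Z := A) (μ ≫ π) (by
    rw [← Category.assoc, ← Category.assoc, whiskerLeft_biact_mul, whiskerLeft_biact_mul]
    simp only [Category.assoc, hc])
  obtain ⟨m, hm⟩ := exists_whiskerRight_coequalizer_desc (biact A r) (biact A s) l (by
    rw [← cancel_epi (_ ◁ coequalizer.π (biact A r) (biact A s))]
    rw [whisker_exchange_assoc, whisker_exchange_assoc, hl, ← Category.assoc, ← Category.assoc,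
      biact_whiskerRight_mul, biact_whiskerRight_mul]
    simp only [Category.assoc, hc])
  exact ⟨m, by rw [MonoidalCategory.tensorHom_def', Category.assoc, hm, hl]⟩

/-- A monoid structure on `Q` for which the epimorphism `π : A ⟶ Q` is a morphism of monoids. -/
@[reducible]
def MonObj.ofEpi {Q : M} (π : A ⟶ Q) [Epi π] (m : Q ⊗ Q ⟶ Q) (hm : (π ⊗ₘ π) ≫ m = μ ≫ π) :
    MonObj Q where
  one := η ≫ π
  mul := m
  one_mul := by
    have h : 𝟙_ M ◁ π ≫ (η ≫ π) ▷ Q = η ▷ A ≫ (π ⊗ₘ π) := by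
      simp [← id_tensorHom, ← tensorHom_id]
    rw [← cancel_epi (_ ◁ π), reassoc_of% h, hm, MonObj.one_mul_assoc, leftUnitor_naturality]
  mul_one := by
    have h : π ▷ 𝟙_ M ≫ Q ◁ (η ≫ π) = A ◁ η ≫ (π ⊗ₘ π) := by
      simp [← id_tensorHom, ← tensorHom_id]
    rw [← cancel_epi (π ▷ _), reassoc_of% h, hm, MonObj.mul_one_assoc, rightUnitor_naturality]
  mul_assoc := by
    have h₁ : ((π ⊗ₘ π) ⊗ₘ π) ≫ m ▷ Q = μ ▷ A ≫ (π ⊗ₘ π) := by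
      simp only [← tensorHom_id, tensorHom_comp_tensorHom, hm, Category.comp_id, Category.id_comp]
    have h₂ : (π ⊗ₘ π ⊗ₘ π) ≫ Q ◁ m = A ◁ μ ≫ (π ⊗ₘ π) := by
      simp only [← id_tensorHom, tensorHom_comp_tensorHom, hm, Category.comp_id, Category.id_comp]
    rw [← cancel_epi ((π ⊗ₘ π) ⊗ₘ π), reassoc_of% h₁, associator_naturality_assoc,
      reassoc_of% h₂, hm, MonObj.mul_assoc_assoc]

/-- The quotient of a monoid object by the two-sided congruence generated by a parallel pair. -/
theorem exists_mon_quotient [HasCoequalizers M] (A : Mon M) {X : M} (r s : X ⟶ A.X) :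
    ∃ (Q : Mon M) (π : A ⟶ Q), Epi π.hom ∧ r ≫ π.hom = s ≫ π.hom ∧
      ∀ ⦃B : Mon M⦄ (f : A ⟶ B), r ≫ f.hom = s ≫ f.hom → ∃ g : Q ⟶ B, π ≫ g = f := by
  obtain ⟨m, hm⟩ := exists_mul_coequalizer_biact r s
  set π := coequalizer.π (biact A.X r) (biact A.X s) with hπ
  let _ : MonObj (coequalizer (biact A.X r) (biact A.X s)) := MonObj.ofEpi π m hm
  have : IsMonHom π := ⟨rfl, hm.symm⟩
  refine ⟨Mon.mk (coequalizer (biact A.X r) (biact A.X s)), ⟨π⟩,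
    inferInstanceAs (Epi π), comp_eq_of_biact_comp_eq π (coequalizer.condition _ _),
    fun B f hf => ?_⟩
  let g := coequalizer.desc f.hom (biact_comp_eq f.hom hf)
  have hg : π ≫ g = f.hom := coequalizer.π_desc _ _
  have : IsMonHom g := ⟨?_, ?_⟩
  · exact ⟨⟨g⟩, Mon.Hom.ext hg⟩
  · change (η ≫ π) ≫ g = _
    rw [Category.assoc, hg, IsMonHom.one_hom]
  · change m ≫ g = _
    rw [← cancel_epi (π ⊗ₘ π), reassoc_of% hm, hg, tensorHom_comp_tensorHom_assoc, hg,
      IsMonHom.mul_hom]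

/-- The quotient of a monoid object by the two-sided congruence generated by a family of parallel
pairs. -/
theorem exists_mon_quotient_family [HasColimitsOfSize.{w, w} M] (A : Mon M) {I : Type w}
    (X : I → M) (r s : ∀ i, X i ⟶ A.X) :
    ∃ (Q : Mon M) (π : A ⟶ Q), Epi π.hom ∧ (∀ i, r i ≫ π.hom = s i ≫ π.hom) ∧
      ∀ ⦃B : Mon M⦄ (f : A ⟶ B), (∀ i, r i ≫ f.hom = s i ≫ f.hom) → ∃ g : Q ⟶ B, π ≫ g = f := by
  have := hasColimitsOfSizeShrink.{0, 0, w, w} M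
  obtain ⟨Q, π, h₁, h₂, h₃⟩ := exists_mon_quotient A (Sigma.desc r) (Sigma.desc s)
  -- A family of relations is a single relation on the coproduct.
  refine ⟨Q, π, h₁, fun i => ?_, fun B f hf => h₃ f (Sigma.hom_ext _ _ fun i => by simp [hf])⟩
  simpa using Sigma.ι X i ≫= h₂

end Quotient

/-! ### Free monoids as objects of words. -/

section FreeMonoid

open MonObj

variable {M : Type u} [Category.{v} M] [MonoidalCategory M]

/-- The `n`-fold tensor power, bracketed to the left. -/
def tensorPow (X : M) : ℕ → M
  | 0 => 𝟙_ M
  | n + 1 => tensorPow X n ⊗ X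

/-- The defining isomorphism of the tensor powers. -/
def tensorPowSucc (X : M) (n : ℕ) : tensorPow X n ⊗ X ≅ tensorPow X (n + 1) := Iso.refl _

variable [HasColimitsOfSize.{0, 0} M]

/-- The underlying object of the free monoid on `X`, the coproduct of the tensor powers of `X`. -/
noncomputable def wordObj (X : M) : M := ∐ fun n : ℕ => tensorPow X n

variable (X : M)

/-- The inclusion of the words of length `n`. -/
noncomputable def wordι (n : ℕ) : tensorPow X n ⟶ wordObj X := Sigma.ι (tensorPow X) n

/-- The empty word. -/
noncomputable def wordNil : 𝟙_ M ⟶ wordObj X := wordι X 0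

variable {X}

/-- The morphism out of `wordObj X` with given restrictions to the words of each length. -/
noncomputable def wordDesc {Y : M} (f : ∀ n, tensorPow X n ⟶ Y) : wordObj X ⟶ Y :=
  Sigma.desc f

lemma wordι_wordDesc {Y : M} (f : ∀ n, tensorPow X n ⟶ Y) (n : ℕ) :
    wordι X n ≫ wordDesc f = f n :=
  Sigma.ι_desc f n

lemma wordObj_hom_ext₀ {Y : M} {f g : wordObj X ⟶ Y} (h : ∀ n, wordι X n ≫ f = wordι X n ≫ g) :
    f = g :=
  Sigma.hom_ext _ _ h

variable [MonoidalClosed M]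

lemma wordObj_hom_ext {Z Y : M} {f g : Z ⊗ wordObj X ⟶ Y}
    (h : ∀ n, Z ◁ wordι X n ≫ f = Z ◁ wordι X n ≫ g) : f = g := by
  apply MonoidalClosed.curry_injective
  apply wordObj_hom_ext₀
  intro n
  rw [← MonoidalClosed.curry_natural_left, ← MonoidalClosed.curry_natural_left, h]

lemma exists_wordObj_desc {Z Y : M} (f : ∀ n, Z ⊗ tensorPow X n ⟶ Y) :
    ∃ l : Z ⊗ wordObj X ⟶ Y, ∀ n, Z ◁ wordι X n ≫ l = f n := by
  refine ⟨MonoidalClosed.uncurry (wordDesc fun n => MonoidalClosed.curry (f n)), fun n => ?_⟩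
  rw [← MonoidalClosed.uncurry_natural_left, wordι_wordDesc, MonoidalClosed.uncurry_curry]

lemma exists_wordObj_desc_right [SymmetricCategory M] {Z Y : M} (f : ∀ n, tensorPow X n ⊗ Z ⟶ Y) :
    ∃ l : wordObj X ⊗ Z ⟶ Y, ∀ n, wordι X n ▷ Z ≫ l = f n := by
  obtain ⟨l, hl⟩ := exists_wordObj_desc fun n => (β_ _ _).hom ≫ f n
  refine ⟨(β_ _ _).hom ≫ l, fun n => ?_⟩
  rw [BraidedCategory.braiding_naturality_left_assoc, hl, SymmetricCategory.symmetry_assoc]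

variable [SymmetricCategory M]

variable (X) in
/-- Appending a letter to a word. -/
noncomputable def wordSnoc : wordObj X ⊗ X ⟶ wordObj X :=
  (exists_wordObj_desc_right fun n => (tensorPowSucc X n).hom ≫ wordι X (n + 1)).choose

lemma wordι_wordSnoc (n : ℕ) :
    wordι X n ▷ X ≫ wordSnoc X = (tensorPowSucc X n).hom ≫ wordι X (n + 1) :=
  (exists_wordObj_desc_right fun n => (tensorPowSucc X n).hom ≫ wordι X (n + 1)).choose_spec n

lemma wordι_succ (n : ℕ) :
    wordι X (n + 1) = (tensorPowSucc X n).inv ≫ wordι X n ▷ X ≫ wordSnoc X := by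
  rw [wordι_wordSnoc, Iso.inv_hom_id_assoc]

/-- A morphism out of `Z ⊗ wordObj X` is determined by its values on empty words and its behaviour
under appending a letter. -/
lemma wordObj_hom_ext_rec {Z Y : M} {h k : Z ⊗ wordObj X ⟶ Y} (a : Y ⊗ X ⟶ Y)
    (nil : Z ◁ wordNil X ≫ h = Z ◁ wordNil X ≫ k)
    (snoc : Z ◁ wordSnoc X ≫ h = (α_ Z (wordObj X) X).inv ≫ h ▷ X ≫ a)
    (snoc' : Z ◁ wordSnoc X ≫ k = (α_ Z (wordObj X) X).inv ≫ k ▷ X ≫ a) : h = k := by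
  apply wordObj_hom_ext
  intro n
  induction n with
  | zero => exact nil
  | succ n ih =>
    simp only [wordι_succ, MonoidalCategory.whiskerLeft_comp, Category.assoc, snoc, snoc',
      associator_inv_naturality_middle_assoc]
    rw [← comp_whiskerRight_assoc, ih, comp_whiskerRight_assoc]

lemma wordObj_tensor_hom_ext {Z Y : M} {f g : Z ⊗ wordObj X ⊗ X ⟶ Y}
    (h : ∀ n, Z ◁ wordι X n ▷ X ≫ f = Z ◁ wordι X n ▷ X ≫ g) : f = g := by
  -- The braiding moves `wordObj X` to the last factor, where `wordObj_hom_ext` applies.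
  rw [← cancel_epi ((α_ Z X (wordObj X)).hom ≫ Z ◁ (β_ X (wordObj X)).hom)]
  apply wordObj_hom_ext
  intro n
  have : (Z ⊗ X) ◁ wordι X n ≫ (α_ Z X (wordObj X)).hom ≫ Z ◁ (β_ X (wordObj X)).hom =
      (α_ _ _ _).hom ≫ Z ◁ (β_ _ _).hom ≫ Z ◁ wordι X n ▷ X := by
    simp [← MonoidalCategory.whiskerLeft_comp]
  simp only [Category.assoc, reassoc_of% this, h]

/-- The recursive definition of a morphism `Z ⊗ wordObj X ⟶ Y`. -/
lemma exists_wordObj_rec {Z Y : M} (z : Z ⟶ Y) (a : Y ⊗ X ⟶ Y) :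
    ∃ h : Z ⊗ wordObj X ⟶ Y, Z ◁ wordNil X ≫ h = (ρ_ Z).hom ≫ z ∧
      Z ◁ wordSnoc X ≫ h = (α_ Z (wordObj X) X).inv ≫ h ▷ X ≫ a := by
  let f (n : ℕ) : Z ⊗ tensorPow X n ⟶ Y :=
    Nat.rec ((ρ_ Z).hom ≫ z) (fun n g => Z ◁ (tensorPowSucc X n).inv ≫
      (α_ Z (tensorPow X n) X).inv ≫ g ▷ X ≫ a) n
  obtain ⟨h, hh⟩ := exists_wordObj_desc f
  refine ⟨h, hh 0, wordObj_tensor_hom_ext fun n => ?_⟩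
  have hs : f (n + 1) =
    Z ◁ (tensorPowSucc X n).inv ≫ (α_ Z (tensorPow X n) X).inv ≫ f n ▷ X ≫ a := rfl
  rw [← MonoidalCategory.whiskerLeft_comp_assoc, wordι_wordSnoc,
    MonoidalCategory.whiskerLeft_comp_assoc, hh, hs, whiskerLeft_hom_inv_assoc,
    associator_inv_naturality_middle_assoc, ← comp_whiskerRight_assoc, hh]

lemma wordObj_hom_ext_rec₀ {Y : M} {h k : wordObj X ⟶ Y} (a : Y ⊗ X ⟶ Y)
    (nil : wordNil X ≫ h = wordNil X ≫ k)
    (snoc : wordSnoc X ≫ h = h ▷ X ≫ a) (snoc' : wordSnoc X ≫ k = k ▷ X ≫ a) : h = k := by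
  apply wordObj_hom_ext₀
  intro n
  induction n with
  | zero => exact nil
  | succ n ih =>
    simp only [wordι_succ, Category.assoc, snoc, snoc']
    rw [← comp_whiskerRight_assoc, ih, comp_whiskerRight_assoc]

lemma exists_wordObj_rec₀ {Y : M} (z : 𝟙_ M ⟶ Y) (a : Y ⊗ X ⟶ Y) :
    ∃ h : wordObj X ⟶ Y, wordNil X ≫ h = z ∧ wordSnoc X ≫ h = h ▷ X ≫ a := by
  obtain ⟨h, h₁, h₂⟩ := exists_wordObj_rec z a
  refine ⟨(λ_ _).inv ≫ h, ?_, ?_⟩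
  · rw [leftUnitor_inv_naturality_assoc, h₁, unitors_inv_equal, Iso.inv_hom_id_assoc]
  · rw [leftUnitor_inv_naturality_assoc, h₂]
    simp

variable (X) in
/-- Concatenation of words. -/
noncomputable def wordMul : wordObj X ⊗ wordObj X ⟶ wordObj X :=
  (exists_wordObj_rec (𝟙 _) (wordSnoc X)).choose

lemma whiskerLeft_wordNil_wordMul : wordObj X ◁ wordNil X ≫ wordMul X = (ρ_ _).hom := by
  rw [wordMul, (exists_wordObj_rec (𝟙 _) (wordSnoc X)).choose_spec.1, Category.comp_id]

lemma whiskerLeft_wordSnoc_wordMul :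
    wordObj X ◁ wordSnoc X ≫ wordMul X = (α_ _ _ _).inv ≫ wordMul X ▷ X ≫ wordSnoc X :=
  (exists_wordObj_rec (𝟙 _) (wordSnoc X)).choose_spec.2

noncomputable instance : MonObj (wordObj X) where
  one := wordNil X
  mul := wordMul X
  one_mul := by
    apply wordObj_hom_ext_rec (wordSnoc X)
    · rw [whisker_exchange_assoc, whiskerLeft_wordNil_wordMul, rightUnitor_naturality,
        leftUnitor_naturality, unitors_equal]
    · rw [whisker_exchange_assoc, whiskerLeft_wordSnoc_wordMul]
      simp
    · simp
  mul_one := whiskerLeft_wordNil_wordMul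
  mul_assoc := by
    apply wordObj_hom_ext_rec (wordSnoc X)
    · rw [whisker_exchange_assoc, whiskerLeft_wordNil_wordMul, rightUnitor_naturality,
        associator_naturality_right_assoc, ← MonoidalCategory.whiskerLeft_comp_assoc,
        whiskerLeft_wordNil_wordMul]
      simp
    · rw [whisker_exchange_assoc, whiskerLeft_wordSnoc_wordMul]
      simp
    · rw [associator_naturality_right_assoc, ← MonoidalCategory.whiskerLeft_comp_assoc,
        whiskerLeft_wordSnoc_wordMul]
      simp [whiskerLeft_wordSnoc_wordMul]

lemma one_wordObj : η[wordObj X] = wordNil X := rfl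

lemma mul_wordObj : μ[wordObj X] = wordMul X := rfl

variable (X) in
/-- The inclusion of the one-letter words. -/
noncomputable def wordSingleton : X ⟶ wordObj X :=
  (λ_ X).inv ≫ wordNil X ▷ X ≫ wordSnoc X

lemma whiskerLeft_wordSingleton_wordMul :
    wordObj X ◁ wordSingleton X ≫ wordMul X = wordSnoc X := by
  simp only [wordSingleton, MonoidalCategory.whiskerLeft_comp, Category.assoc,
    whiskerLeft_wordSnoc_wordMul, associator_inv_naturality_middle_assoc]
  rw [← comp_whiskerRight_assoc, whiskerLeft_wordNil_wordMul]
  simp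

lemma wordSnoc_comp {B : M} [MonObj B] (g : wordObj X ⟶ B) [IsMonHom g] :
    wordSnoc X ≫ g = g ▷ X ≫ B ◁ (wordSingleton X ≫ g) ≫ μ := by
  rw [← whiskerLeft_wordSingleton_wordMul, Category.assoc, ← mul_wordObj, IsMonHom.mul_hom]
  simp [MonoidalCategory.tensorHom_def, whisker_exchange_assoc]

lemma wordObj_monHom_ext {B : M} [MonObj B] {g k : wordObj X ⟶ B} [IsMonHom g] [IsMonHom k]
    (h : wordSingleton X ≫ g = wordSingleton X ≫ k) : g = k := by
  apply wordObj_hom_ext_rec₀ (B ◁ (wordSingleton X ≫ g) ≫ μ)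
  · rw [← one_wordObj, IsMonHom.one_hom, IsMonHom.one_hom]
  · rw [wordSnoc_comp]
  · rw [h, wordSnoc_comp]

lemma exists_wordObj_lift {B : M} [MonObj B] (f : X ⟶ B) :
    ∃ g : wordObj X ⟶ B, IsMonHom g ∧ wordSingleton X ≫ g = f := by
  obtain ⟨g, h₁, h₂⟩ := exists_wordObj_rec₀ (X := X) η[B] (B ◁ f ≫ μ)
  refine ⟨g, ⟨h₁, ?_⟩, ?_⟩
  · rw [mul_wordObj]
    -- Multiplicativity is an induction on the second word: on both sides, appending a letter
    -- multiplies by its image under `f`.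
    apply wordObj_hom_ext_rec (B ◁ f ≫ μ)
    · rw [reassoc_of% whiskerLeft_wordNil_wordMul, MonoidalCategory.tensorHom_def',
        Category.assoc, ← MonoidalCategory.whiskerLeft_comp_assoc, h₁, whisker_exchange_assoc]
      simp
    · rw [reassoc_of% whiskerLeft_wordSnoc_wordMul, h₂]
      simp
    · rw [MonoidalCategory.tensorHom_def', Category.assoc,
        ← MonoidalCategory.whiskerLeft_comp_assoc, h₂, whisker_exchange_assoc]
      simp only [comp_whiskerRight, tensor_whiskerLeft, MonoidalCategory.whiskerLeft_comp,
        Category.assoc, MonObj.mul_assoc, ← whisker_exchange_assoc, Iso.inv_hom_id_assoc]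
      simp
      rw [← associator_inv_naturality_left_assoc, Iso.inv_hom_id_assoc]
      simp only [← whisker_exchange_assoc]
      rw [← MonoidalCategory.whiskerLeft_comp_assoc, whisker_exchange,
        MonoidalCategory.whiskerLeft_comp_assoc]
  · rw [wordSingleton, Category.assoc, Category.assoc, h₂, ← comp_whiskerRight_assoc, h₁,
      ← whisker_exchange_assoc, MonObj.one_mul, leftUnitor_naturality, Iso.inv_hom_id_assoc]

end FreeMonoid

/-! ### Colimits of monoid objects. -/

section Colimits

variable {M : Type u} [Category.{v} M] [MonoidalCategory M] [SymmetricCategory M] [MonoidalClosed M]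
  [HasColimitsOfSize.{w, w} M]

/-- The category of monoid objects in a cocomplete closed symmetric monoidal category is
cocomplete. -/
theorem hasColimitsOfSize_mon : HasColimitsOfSize.{w, w} (Mon M) where
  has_colimits_of_shape J _ := ⟨fun F => by
    have := hasColimitsOfSizeShrink.{0, 0, w, w} M
    let X := colimit (F ⋙ Mon.forget M)
    let κ (j : J) : (F.obj j).X ⟶ wordObj X := colimit.ι (F ⋙ Mon.forget M) j ≫ wordSingleton X
    have hκ {i j : J} (f : i ⟶ j) : (F.map f).hom ≫ κ j = κ i :=
      (colimit.w_assoc (F ⋙ Mon.forget M) f _)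
    -- The left summand of relations makes each `κ j` unital in the quotient, the right one makes it
    -- multiplicative.
    obtain ⟨Q, π, hπ, h₁, h₂⟩ := exists_mon_quotient_family (Mon.mk (wordObj X))
      (Sum.elim (fun _ : J => 𝟙_ M) fun j : J => (F.obj j).X ⊗ (F.obj j).X)
      (Sum.rec (fun j => MonObj.one ≫ κ j) fun j => MonObj.mul ≫ κ j)
      (Sum.rec (fun _ => MonObj.one) fun j => (κ j ⊗ₘ κ j) ≫ MonObj.mul)
    have one (j : J) : MonObj.one ≫ κ j ≫ π.hom = MonObj.one := by
      simpa using h₁ (Sum.inl j)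
    have mul (j : J) : MonObj.mul ≫ κ j ≫ π.hom = (κ j ≫ π.hom ⊗ₘ κ j ≫ π.hom) ≫ MonObj.mul := by
      simpa using h₁ (Sum.inr j)
    let c : Cocone F :=
      { pt := Q
        ι := { app j := Mon.Hom.mk' (κ j ≫ π.hom) (one j) (mul j)
               naturality i j f := by
                ext
                simp [reassoc_of% hκ f] } }
    have desc (s : Cocone F) : ∃ g : Q ⟶ s.pt, ∀ j, c.ι.app j ≫ g = s.ι.app j := by
      obtain ⟨k, hk, hk'⟩ := exists_wordObj_lift (B := s.pt.X)
        (colimit.desc (F ⋙ Mon.forget M) ((Mon.forget M).mapCocone s))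
      have hκk (j : J) : κ j ≫ k = (s.ι.app j).hom :=
        (Category.assoc _ _ _).trans
        ((congrArg (_ ≫ ·) hk').trans (colimit.ι_desc _ _))
      obtain ⟨g, hg⟩ := h₂ (B := s.pt) ⟨k⟩ (by
        rintro (j | j)
        · simp [hκk]
        · simp [hκk])
      refine ⟨g, fun j => ?_⟩
      ext
      have := congr($(hg).hom)
      simp at this
      simp [c, this, hκk]
    choose d hd using desc
    exact ⟨⟨c, d, hd, fun s m hm => by
      ext
      have hπm (g : Q ⟶ s.pt) (j : J) : colimit.ι (F ⋙ Mon.forget M) j ≫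
          wordSingleton (colimit (F ⋙ Mon.forget M)) ≫ (π ≫ g).hom = (c.ι.app j ≫ g).hom := by
        simp only [c, κ, X, Mon.comp_hom']
        exact (Category.assoc _ _ _).symm.trans (Category.assoc _ _ _).symm
      rw [← cancel_epi π.hom]
      apply wordObj_monHom_ext (g := (π ≫ m).hom) (k := (π ≫ d s).hom)
      apply colimit.hom_ext
      intro j
      rw [hπm, hπm, hm, hd]⟩⟩⟩

end Colimits

/-! ### Reflection onto the `⊥`-commutative functors. -/

section Reflection

variable {C : Type w} [SmallCategory C] (O : OrthogonalityRelation C)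
  {M : Type u} [Category.{v} M] [MonoidalCategory M] [SymmetricCategory M] [MonoidalClosed M]
  [HasColimitsOfSize.{w, w} M]

/-- A commutation relation imposed on the value at `c` of a functor: a pair of orthogonal morphisms
with target `c`. -/
structure PerpPair (c : C) where
  {c₁ c₂ : C}
  f₁ : c₁ ⟶ c
  f₂ : c₂ ⟶ c
  perp : O.Perp f₁ f₂

variable {O}

lemma exists_perp_quotient (A : C ⥤ Mon M) (c : C) :
    ∃ (Q : Mon M) (π : A.obj c ⟶ Q), Epi π.hom ∧
      (∀ p : PerpPair O c,
        (((A.map p.f₁).hom ⊗ₘ (A.map p.f₂).hom) ≫ MonObj.mul) ≫ π.hom =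
          (((A.map p.f₁).hom ⊗ₘ (A.map p.f₂).hom) ≫ (β_ _ _).hom ≫ MonObj.mul) ≫ π.hom) ∧
      ∀ ⦃B : Mon M⦄ (f : A.obj c ⟶ B),
        (∀ p : PerpPair O c,
          (((A.map p.f₁).hom ⊗ₘ (A.map p.f₂).hom) ≫ MonObj.mul) ≫ f.hom =
            (((A.map p.f₁).hom ⊗ₘ (A.map p.f₂).hom) ≫ (β_ _ _).hom ≫ MonObj.mul) ≫ f.hom) →
          ∃ g : Q ⟶ B, π ≫ g = f :=
  exists_mon_quotient_family (A.obj c)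
    (fun p : PerpPair O c => (A.obj p.c₁).X ⊗ (A.obj p.c₂).X) _ _

omit [SymmetricCategory M] [MonoidalClosed M] [HasColimitsOfSize.{w, w} M] in
lemma tensorHom_mul_comp {X Y : M} {A B : Mon M} (a : X ⟶ A.X) (b : Y ⟶ A.X) (f : A ⟶ B) :
    ((a ⊗ₘ b) ≫ MonObj.mul) ≫ f.hom = (a ≫ f.hom ⊗ₘ b ≫ f.hom) ≫ MonObj.mul := by
  rw [Category.assoc, IsMonHom.mul_hom, tensorHom_comp_tensorHom_assoc]

omit [MonoidalClosed M] [HasColimitsOfSize.{w, w} M] in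
lemma tensorHom_braiding_mul_comp {X Y : M} {A B : Mon M} (a : X ⟶ A.X) (b : Y ⟶ A.X)
    (f : A ⟶ B) :
    ((a ⊗ₘ b) ≫ (β_ _ _).hom ≫ MonObj.mul) ≫ f.hom =
      (a ≫ f.hom ⊗ₘ b ≫ f.hom) ≫ (β_ _ _).hom ≫ MonObj.mul := by
  rw [Category.assoc, Category.assoc, IsMonHom.mul_hom,
    ← BraidedCategory.braiding_naturality_assoc, tensorHom_comp_tensorHom_assoc]

omit [MonoidalClosed M] [HasColimitsOfSize.{w, w} M] in
lemma perp_relation_iff {A : C ⥤ Mon M} {c : C} {B : Mon M} (f : A.obj c ⟶ B) (p : PerpPair O c) :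
    (((A.map p.f₁).hom ⊗ₘ (A.map p.f₂).hom) ≫ MonObj.mul) ≫ f.hom =
        (((A.map p.f₁).hom ⊗ₘ (A.map p.f₂).hom) ≫ (β_ _ _).hom ≫ MonObj.mul) ≫ f.hom ↔
      ((A.map p.f₁ ≫ f).hom ⊗ₘ (A.map p.f₂ ≫ f).hom) ≫ MonObj.mul =
        ((A.map p.f₁ ≫ f).hom ⊗ₘ (A.map p.f₂ ≫ f).hom) ≫ (β_ _ _).hom ≫ MonObj.mul := by
  rw [tensorHom_mul_comp, tensorHom_braiding_mul_comp]
  rfl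

variable (O) in
/-- Every functor has a universal morphism to a `⊥`-commutative functor. -/
theorem exists_perpCommutative_reflection (A : C ⥤ Mon M) :
    ∃ (Q : C ⥤ Mon M) (π : A ⟶ Q), IsPerpCommutative O M Q ∧
      ∀ B : C ⥤ Mon M, IsPerpCommutative O M B → ∀ f : A ⟶ B, ∃! g : Q ⟶ B, π ≫ g = f := by
  choose Q π hπ rel desc using exists_perp_quotient (O := O) A
  simp only [perp_relation_iff] at rel desc
  have cancel {c : C} {B : Mon M} {g k : Q c ⟶ B} (h : π c ≫ g = π c ≫ k) : g = k := by
    ext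
    rw [← cancel_epi (π c).hom]
    exact congr($(h).hom)
  have map {c d : C} (g : c ⟶ d) : ∃ k : Q c ⟶ Q d, π c ≫ k = A.map g ≫ π d := by
    refine desc c _ fun p => ?_
    -- Postcomposing with `g` sends relations at `c` to relations at `d`.
    have h := O.comp_stable g (𝟙 _) (𝟙 _) p.perp
    rw [Category.id_comp, Category.id_comp] at h
    simpa only [Functor.map_comp, Category.assoc] using rel d ⟨_, _, h⟩
  choose k hk using @map
  let R : C ⥤ Mon M :=
    { obj := Q
      map g := k g
      map_id c := cancel (by rw [hk]; simp)
      map_comp g h := cancel (by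
        rw [hk, reassoc_of% hk g, hk, Functor.map_comp, Category.assoc]) }
  refine ⟨R, ⟨π, fun c d g => (hk g).symm⟩, fun c₁ c₂ c f₁ f₂ h => ?_, fun B hB f => ?_⟩
  -- A tensor product of epimorphisms is epi, so commutation can be checked on the images of `A`.
  · rw [← cancel_epi ((π c₁).hom ⊗ₘ (π c₂).hom), tensorHom_comp_tensorHom_assoc,
      tensorHom_comp_tensorHom_assoc]
    have h₁ : (π c₁).hom ≫ (R.map f₁).hom = (A.map f₁ ≫ π c).hom := congr($(hk f₁).hom)
    have h₂ : (π c₂).hom ≫ (R.map f₂).hom = (A.map f₂ ≫ π c).hom := congr($(hk f₂).hom)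
    rw [h₁, h₂]
    exact rel c ⟨f₁, f₂, h⟩
  · have hf (c : C) : ∃ g : Q c ⟶ B.obj c, π c ≫ g = f.app c := by
      refine desc c _ fun p => ?_
      rw [f.naturality, f.naturality]
      have := ((f.app p.c₁).hom ⊗ₘ (f.app p.c₂).hom) ≫= hB p.f₁ p.f₂ p.perp
      simpa only [tensorHom_comp_tensorHom_assoc, Mon.comp_hom'] using this
    choose g hg using hf
    refine ⟨⟨g, fun c d h => cancel ?_⟩, ?_, fun g' hg' => ?_⟩
    · change π c ≫ k h ≫ g d = _
      rw [reassoc_of% hk h, hg, reassoc_of% hg c, f.naturality]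
    · ext c : 2
      exact hg c
    · ext c : 2
      apply cancel
      rw [hg, ← hg']
      rfl

variable (O M) in
theorem isRightAdjoint_isPerpCommutative_ι : (IsPerpCommutative O M).ι.IsRightAdjoint := by
  rw [isRightAdjoint_iff_hasInitial_structuredArrow]
  intro A
  obtain ⟨Q, π, hQ, h⟩ := exists_perpCommutative_reflection O A
  let R : QFT O M := ⟨Q, hQ⟩
  let S : StructuredArrow A (IsPerpCommutative O M).ι := StructuredArrow.mk (Y := R) π
  refine IsInitial.hasInitial (X := S) (IsInitial.ofUniqueHom
    (fun T => StructuredArrow.homMk ⟨(h T.right.obj T.right.property T.hom).choose⟩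
      (h T.right.obj T.right.property T.hom).choose_spec.1) fun T m => ?_)
  ext : 2
  exact (h T.right.obj T.right.property T.hom).choose_spec.2 _ (StructuredArrow.w m)

end Reflection

theorem proposition2p7 {C : Type w} [SmallCategory C] (O : OrthogonalityRelation C)
    (M : Type u) [Category.{v} M] [MonoidalCategory M] [SymmetricCategory M] [MonoidalClosed M]
    [HasLimitsOfSize.{w, w} M] [HasColimitsOfSize.{w, w} M] :
    HasLimitsOfSize.{w, w} (QFT O M) ∧ HasColimitsOfSize.{w, w} (QFT O M) := by
  have := isRightAdjoint_isPerpCommutative_ι O M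
  have := hasColimitsOfSize_mon (M := M)
  let _ : Reflective (IsPerpCommutative O M).ι :=
    ⟨_, Adjunction.ofIsRightAdjoint _⟩
  have : HasLimitsOfSize.{w, w} (Mon M) := ⟨fun _ _ => inferInstance⟩
  exact ⟨hasLimits_of_reflective (IsPerpCommutative O M).ι,
    hasColimits_of_reflective (IsPerpCommutative O M).ι⟩
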